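/- Consider a free-space optical system in which a source $S$ communicates with a destination $D$, without direct link, through $N\ge 1$ decode-and-forward relays $R_1,\dots,R_N$. Each link $AB\in\{SR_m,\,R_mD : 1\le m\le N\}$ has channel gain $h_{AB}=\bar h_{AB}\tilde h_{AB}$, where $\bar h_{AB}>0$ is a constant and the $2N$ random variables $\tilde h_{AB}$ are independent, $\tilde h_{AB}$ having the Gamma-Gamma density $$f(x)=\frac{2(\alpha\beta)^{\frac{\alpha+\beta}{2}}}{\Gamma(\alpha)\Gamma(\beta)}\,x^{\frac{\alpha+\beta}{2}-1}K_{\alpha-\beta}\bigl(2\sqrt{\alpha\beta x}\bigr),\qquad x>0,$$ with $\alpha=\alpha_{AB}>0$, $\beta=\beta_{AB}>0$ and $\alpha_{AB}-\beta_{AB}\notin\mathbb Z$; here $K_\nu$ is the modified Bessel function of the second kind. Put $q_{AB}=\min(\alpha_{AB},\beta_{AB})$. A fixed fraction $\rho_{AB}>0$ of the total optical power $P_t$ is allocated to link $AB$, with $\sum_{m=1}^N(\rho_{SR_m}+\rho_{R_mD})=1$. Let $\eta,T_b,N_0,\gamma_{th}>0$ be the detector responsivity, slot duration, noise level and threshold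 signal-to-noise ratio (SNR), and let $P_M=\eta T_bP_t/\sqrt{N_0\gamma_{th}}$ be the power margin. In all-active relaying, relay $R_m$ decodes (and forwards) if and only if its SNR $\eta^2T_b^2P_t^2\rho_{SR_m}^2h_{SR_m}^2/N_0$ exceeds $\gamma_{th}$; let $\mathbf D\subseteq\{1,\dots,N\}$ be the random set of decoding relays. An outage occurs if $\mathbf D=\emptyset$ or the SNR at the destination, $\eta^2T_b^2P_t^2\bigl(\sum_{m\in\mathbf D}\rho_{R_mD}h_{R_mD}\bigr)^2/N_0$, is less than $\gamma_{th}$. Let $P_{out}$ be the probability of outage. Then the diversity gain $G_d=-\lim_{P_M\to\infty}\dfrac{\log P_{out}}{\log P_M}$ exists and $$G_d=\min_{S\subseteq\{1,\dots,N\}}\Bigl(\sum_{m\notin S}q_{SR_m}+\sum_{m\in S}q_{R_mD}\Bigr).$$ -/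

import Mathlib

open MeasureTheory ProbabilityTheory Filter Topology

noncomputable section

namespace FSO

/-- The modified Bessel function of the second kind of real order `ν`, for an argument `z > 0`:
`K_ν(z) = ∫₀^∞ exp(-z cosh t) cosh(ν t) dt`. -/
def besselK (ν z : ℝ) : ℝ :=
  ∫ t in Set.Ioi (0 : ℝ), Real.exp (-z * Real.cosh t) * Real.cosh (ν * t)

/-- The Gamma-Gamma probability density with parameters `α, β > 0`, supported on `(0, ∞)`. -/
def gammaGammaPDFReal (α β x : ℝ) : ℝ :=
  if 0 < x then
    2 * (α * β) ^ ((α + β) / 2) / (Real.Gamma α * Real.Gamma β) * x ^ ((α + β) / 2 - 1)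
      * besselK (α - β) (2 * √(α * β * x))
  else 0

/-- The Gamma-Gamma distribution on `ℝ`. -/
def gammaGammaMeasure (α β : ℝ) : Measure ℝ :=
  volume.withDensity fun x => ENNReal.ofReal (gammaGammaPDFReal α β x)

/-- The free-space optical links of a system with `N` relays and no direct source-destination
link: `SR m` joins the source to relay `m`, and `RD m` joins relay `m` to the destination. -/
inductive Link (N : ℕ) where
  | SR (m : Fin N) : Link N
  | RD (m : Fin N) : Link N

/-- The power and detection parameters shared by all links. -/
structure OpticalParams where
  /-- photodetector responsivity -/
  eta : ℝ
  /-- duration of the signal and non-signal slots -/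
  Tb : ℝ
  /-- total transmitted optical power -/
  Pt : ℝ
  /-- noise level (the noise variance is `N0 / 2`) -/
  N0 : ℝ
  /-- threshold signal-to-noise ratio -/
  gammaTh : ℝ
  eta_pos : 0 < eta
  Tb_pos : 0 < Tb
  Pt_pos : 0 < Pt
  N0_pos : 0 < N0
  gammaTh_pos : 0 < gammaTh

/-- The power margin `P_M = η T_b P_t / √(N₀ γ_th)`. -/
def OpticalParams.powerMargin (s : OpticalParams) : ℝ :=
  s.eta * s.Tb * s.Pt / √(s.N0 * s.gammaTh)

/-- The instantaneous SNR `η² T_b² P_t² g² / N₀` of a received signal whose optical power is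
`g P_t`. For one link `g = ρ h`; for several superposed signals `g` is the sum of the `ρ h`. -/
def OpticalParams.snr (s : OpticalParams) (g : ℝ) : ℝ :=
  s.eta ^ 2 * s.Tb ^ 2 * s.Pt ^ 2 * g ^ 2 / s.N0

variable {N : ℕ} {Ω : Type*}

/-- The channel gain `h = h̄ h̃` of a link: path loss times turbulence-induced fading. -/
def channelGain (hbar : Link N → ℝ) (htilde : Link N → Ω → ℝ) (l : Link N) (ω : Ω) : ℝ :=
  hbar l * htilde l ω

open Classical in
/-- The decoding set: the relays whose source-relay SNR exceeds the threshold. -/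
def decodingSet (s : OpticalParams) (ρ hbar : Link N → ℝ) (htilde : Link N → Ω → ℝ) (ω : Ω) :
    Finset (Fin N) :=
  {m | s.gammaTh < s.snr (ρ (Link.SR m) * channelGain hbar htilde (Link.SR m) ω)}

/-- The SNR at the destination, where the signals of all decoding relays are added. -/
def destinationSNR (s : OpticalParams) (ρ hbar : Link N → ℝ) (htilde : Link N → Ω → ℝ) (ω : Ω) :
    ℝ :=
  s.snr (∑ m ∈ decodingSet s ρ hbar htilde ω,
    ρ (Link.RD m) * channelGain hbar htilde (Link.RD m) ω)

/-- The outage probability of all-active relaying: no relay decodes, or the SNR at the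
destination falls below the threshold. -/
def allActiveOutage [MeasurableSpace Ω] (μ : Measure Ω) (ρ hbar : Link N → ℝ)
    (htilde : Link N → Ω → ℝ) (s : OpticalParams) : ℝ :=
  μ.real {ω | decodingSet s ρ hbar htilde ω = ∅ ∨ destinationSNR s ρ hbar htilde ω < s.gammaTh}

/-- `G` is the diversity gain of a scheme with outage probability `Pout`: the limit
`-lim log Pout / log P_M` as `P_M → ∞` exists and equals `G`. -/
def HasDiversityGain (Pout : OpticalParams → ℝ) (G : ℝ) : Prop :=
  Tendsto (fun s : OpticalParams => -(Real.log (Pout s) / Real.log s.powerMargin))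
    (comap OpticalParams.powerMargin atTop) (𝓝 G)

end FSO

end

noncomputable section

namespace FSO

/-! Each relay `m` contributes one fade to an outage: its first hop if it does not decode, its
second hop if it does. Up to constants in the fade thresholds, outage is therefore a union over sets
`S` of the events that all links `criticalLink S m` have fading at most `a / P_M`
(`exists_fade_of_outage`, `outage_of_fade`). By independence such an event has probability `P_M ^
(-∑ q)` up to `P_M ^ (±ε)`, since the Gamma-Gamma distribution function behaves like `x ^ min α β`
near `0`. The union bound over the finitely many `S` costs only a constant, so the smallest exponent
wins.

Only logarithmic asymptotics matter, so crude bounds on `besselK` suffice: `besselK_le` loses an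
arbitrarily small power and `le_besselK` a constant. -/

/-! ### Power bounds for the Bessel function near zero. -/

theorem rpow_le_rpow_self_mul_exp {p y : ℝ} (hp : 0 < p) (hy : 0 ≤ y) :
    y ^ p ≤ p ^ p * Real.exp y := by
  have h1 : y / p ≤ Real.exp (y / p) := by linarith [Real.add_one_le_exp (y / p)]
  have h2 := Real.rpow_le_rpow (by positivity) h1 hp.le
  rw [Real.div_rpow hy hp.le, ← Real.exp_mul, div_mul_cancel₀ _ hp.ne',
    div_le_iff₀ (by positivity)] at h2
  linarith

theorem cosh_mul_le_exp {ν t : ℝ} (ht : 0 ≤ t) : Real.cosh (ν * t) ≤ Real.exp (|ν| * t) := by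
  rw [← Real.cosh_abs, abs_mul, abs_of_nonneg ht, Real.cosh_eq]
  have : Real.exp (-(|ν| * t)) ≤ Real.exp (|ν| * t) := Real.exp_le_exp.2 (by
    have : 0 ≤ |ν| * t := by positivity
    linarith)
  linarith

theorem exp_div_two_le_cosh (t : ℝ) : Real.exp t / 2 ≤ Real.cosh t := by
  rw [Real.cosh_eq]
  linarith [Real.exp_pos (-t)]

/-- With `y = (z / 2) * exp t ≤ z * cosh t`, the bound `exp (-y) ≤ p ^ p * y ^ (-p)` trades
double-exponential decay for a power of `z`. The result is integrable in `t` once `p > |ν|`. -/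
theorem besselK_integrand_le {ν p z t : ℝ} (hp : 0 < p) (hz : 0 < z) (ht : 0 ≤ t) :
    Real.exp (-z * Real.cosh t) * Real.cosh (ν * t) ≤
      p ^ p * (z / 2) ^ (-p) * Real.exp (-(p - |ν|) * t) := by
  have h1 : Real.exp (-z * Real.cosh t) ≤ p ^ p * (z / 2) ^ (-p) * Real.exp (-(p * t)) := by
    have h2 : Real.exp (-z * Real.cosh t) ≤ Real.exp (-(z / 2 * Real.exp t)) := by
      apply Real.exp_le_exp.2
      nlinarith [exp_div_two_le_cosh t]
    have h3 := rpow_le_rpow_self_mul_exp hp (y := z / 2 * Real.exp t) (by positivity)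
    rw [Real.mul_rpow (by positivity) (by positivity), ← Real.exp_mul] at h3
    refine h2.trans ?_
    rw [Real.exp_neg, Real.exp_neg, Real.rpow_neg (by positivity), inv_le_iff_one_le_mul₀ (by positivity)]
    have h4 : 0 < (z / 2) ^ p * Real.exp (t * p) := by positivity
    rw [mul_comm p t]
    calc (1 : ℝ) ≤ p ^ p * Real.exp (z / 2 * Real.exp t) / ((z / 2) ^ p * Real.exp (t * p)) :=
          (one_le_div h4).2 h3
      _ = _ := by field_simp
  calc _ ≤ (p ^ p * (z / 2) ^ (-p) * Real.exp (-(p * t))) * Real.exp (|ν| * t) :=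
        mul_le_mul h1 (cosh_mul_le_exp ht) (Real.cosh_pos _).le (by positivity)
    _ = _ := by rw [mul_assoc, ← Real.exp_add]; congr 2; ring

theorem integrableOn_besselK (ν : ℝ) {z : ℝ} (hz : 0 < z) :
    IntegrableOn (fun t => Real.exp (-z * Real.cosh t) * Real.cosh (ν * t)) (Set.Ioi 0) := by
  have hp : 0 < |ν| + 1 := by positivity
  have hi : IntegrableOn (fun t : ℝ => (|ν| + 1) ^ (|ν| + 1) * (z / 2) ^ (-(|ν| + 1)) *
      Real.exp (-(|ν| + 1 - |ν|) * t)) (Set.Ioi 0) :=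
    (integrableOn_exp_mul_Ioi (by linarith) 0).const_mul _
  refine Integrable.mono' hi (by fun_prop) ?_
  filter_upwards [ae_restrict_mem measurableSet_Ioi] with t ht
  rw [Real.norm_of_nonneg (mul_nonneg (Real.exp_pos _).le (Real.cosh_pos _).le)]
  exact besselK_integrand_le hp hz (le_of_lt ht)

theorem besselK_le {ν p z : ℝ} (hp : |ν| < p) (hz : 0 < z) :
    besselK ν z ≤ p ^ p * (z / 2) ^ (-p) / (p - |ν|) := by
  have hp0 : 0 < p := (abs_nonneg ν).trans_lt hp
  have hneg : -(p - |ν|) < 0 := by linarith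
  calc besselK ν z ≤ ∫ t in Set.Ioi (0 : ℝ),
        p ^ p * (z / 2) ^ (-p) * Real.exp (-(p - |ν|) * t) :=
        setIntegral_mono_on (integrableOn_besselK ν hz)
          ((integrableOn_exp_mul_Ioi hneg 0).const_mul _) measurableSet_Ioi
          fun t ht => besselK_integrand_le hp0 hz (le_of_lt ht)
    _ = _ := by
      rw [integral_const_mul, integral_exp_mul_Ioi hneg]
      simp only [mul_zero, Real.exp_zero]
      rw [neg_div_neg_eq]
      ring

/-- On the unit window starting at `t = -log z`, `z * cosh t` is still at most `e`, while `cosh (ν *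
t)` has already reached `z ^ (-|ν|) / 2`. -/
theorem le_besselK (ν : ℝ) {z : ℝ} (hz : 0 < z) (hz1 : z ≤ 1) :
    Real.exp (-Real.exp 1) / 2 * z ^ (-|ν|) ≤ besselK ν z := by
  have hT : 0 ≤ -Real.log z := by linarith [Real.log_nonpos hz.le hz1]
  have hsub : Set.Ioc (-Real.log z) (-Real.log z + 1) ⊆ Set.Ioi 0 := fun t ht => hT.trans_lt ht.1
  have hint := integrableOn_besselK ν hz
  calc _ = ∫ t in Set.Ioc (-Real.log z) (-Real.log z + 1),
        Real.exp (-Real.exp 1) / 2 * z ^ (-|ν|) := by simp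
    _ ≤ ∫ t in Set.Ioc (-Real.log z) (-Real.log z + 1),
        Real.exp (-z * Real.cosh t) * Real.cosh (ν * t) := by
      refine setIntegral_mono_on (integrableOn_const (by simp)) (hint.mono_set hsub) measurableSet_Ioc fun t ht => ?_
      have ht0 : 0 < t := hsub ht
      have h1 : Real.exp (-Real.exp 1) ≤ Real.exp (-z * Real.cosh t) := by
        apply Real.exp_le_exp.2
        have h2 : Real.cosh t ≤ Real.exp t := by
          simpa using cosh_mul_le_exp (ν := 1) ht0.le
        have h3 : Real.exp t ≤ Real.exp 1 / z := by
          calc _ ≤ Real.exp (1 - Real.log z) := Real.exp_le_exp.2 (by linarith [ht.2])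
            _ = _ := by rw [Real.exp_sub, Real.exp_log hz]
        have h4 := (le_div_iff₀ hz).1 (h2.trans h3)
        linarith
      have h5 : z ^ (-|ν|) / 2 ≤ Real.cosh (ν * t) := by
        rw [← Real.cosh_abs, abs_mul, abs_of_pos ht0]
        refine le_trans ?_ (exp_div_two_le_cosh _)
        rw [Real.rpow_def_of_pos hz]
        have h6 := mul_le_mul_of_nonneg_left ht.1.le (abs_nonneg ν)
        exact div_le_div_of_nonneg_right (Real.exp_le_exp.2 (by linarith)) zero_le_two
      calc _ = Real.exp (-Real.exp 1) * (z ^ (-|ν|) / 2) := by ring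
        _ ≤ _ := mul_le_mul h1 h5 (by positivity) (by positivity)
    _ ≤ _ := setIntegral_mono_set hint
        (Eventually.of_forall fun t => mul_nonneg (Real.exp_pos _).le (Real.cosh_pos _).le)
        hsub.eventuallyLE

theorem besselK_nonneg (ν z : ℝ) : 0 ≤ besselK ν z :=
  integral_nonneg fun _ => mul_nonneg (Real.exp_pos _).le (Real.cosh_pos _).le

/-! ### The Gamma-Gamma law near zero. -/

theorem min_eq_half_sub_abs (a b : ℝ) : min a b = (a + b) / 2 - |a - b| / 2 := by
  rcases le_total a b with h | h
  · rw [min_eq_left h, abs_of_nonpos (by linarith)]; ring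
  · rw [min_eq_right h, abs_of_nonneg (by linarith)]; ring

theorem mul_sqrt_rpow {c a x r : ℝ} (hc : 0 ≤ c) (ha : 0 ≤ a) (hx : 0 ≤ x) :
    (c * √(a * x)) ^ r = c ^ r * a ^ (r / 2) * x ^ (r / 2) := by
  rw [Real.mul_rpow hc (Real.sqrt_nonneg _), Real.sqrt_eq_rpow,
    ← Real.rpow_mul (mul_nonneg ha hx), Real.mul_rpow ha hx, mul_assoc]
  congr 3 <;> ring

theorem exists_gammaGammaPDFReal_le {α β ε : ℝ} (hα : 0 < α) (hβ : 0 < β) (hε : 0 < ε) :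
    ∃ C > 0, ∀ x > 0, gammaGammaPDFReal α β x ≤ C * x ^ (min α β - ε - 1) := by
  have hΓα := Real.Gamma_pos_of_pos hα
  have hΓβ := Real.Gamma_pos_of_pos hβ
  -- The Bessel argument is of order `√x`, so an excess of `2 * ε` in `p` costs `x ^ (-ε)`.
  set p := |α - β| + 2 * ε with hp
  have hp0 : 0 < p := by positivity
  refine ⟨2 * (α * β) ^ ((α + β) / 2) / (Real.Gamma α * Real.Gamma β) *
    (p ^ p * (1 ^ (-p) * (α * β) ^ (-p / 2)) / (p - |α - β|)), ?_, fun x hx => ?_⟩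
  · have : 0 < p - |α - β| := by rw [hp]; linarith
    positivity
  · have hb := besselK_le (ν := α - β) (p := p) (z := 2 * √(α * β * x)) (by linarith)
      (by positivity)
    rw [mul_div_cancel_left₀ _ (two_ne_zero' ℝ), ← one_mul (√(α * β * x)),
      mul_sqrt_rpow zero_le_one (by positivity) hx.le] at hb
    rw [one_mul] at hb
    have he : x ^ (min α β - ε - 1) = x ^ ((α + β) / 2 - 1) * x ^ (-p / 2) := by
      rw [← Real.rpow_add hx, min_eq_half_sub_abs, hp]; congr 1; ring
    rw [gammaGammaPDFReal, if_pos hx, he]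
    calc _ ≤ 2 * (α * β) ^ ((α + β) / 2) / (Real.Gamma α * Real.Gamma β) * x ^ ((α + β) / 2 - 1) * _ :=
          mul_le_mul_of_nonneg_left hb (by positivity)
      _ = _ := by ring

theorem exists_le_gammaGammaPDFReal {α β : ℝ} (hα : 0 < α) (hβ : 0 < β) :
    ∃ c > 0, ∀ᶠ x in 𝓝[>] (0 : ℝ), c * x ^ (min α β - 1) ≤ gammaGammaPDFReal α β x := by
  have hΓα := Real.Gamma_pos_of_pos hα
  have hΓβ := Real.Gamma_pos_of_pos hβ
  refine ⟨2 * (α * β) ^ ((α + β) / 2) / (Real.Gamma α * Real.Gamma β) *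
    (Real.exp (-Real.exp 1) / 2 * (2 ^ (-|α - β|) * (α * β) ^ (-|α - β| / 2))),
    by positivity, ?_⟩
  have hlim : Tendsto (fun x : ℝ => 2 * √(α * β * x)) (𝓝[>] 0) (𝓝 0) := by
    have : Continuous fun x : ℝ => 2 * √(α * β * x) := by fun_prop
    simpa using (this.tendsto 0).mono_left nhdsWithin_le_nhds
  filter_upwards [hlim.eventually (ge_mem_nhds zero_lt_one), self_mem_nhdsWithin] with x hx1 hx
  replace hx : 0 < x := hx
  have hb := le_besselK (α - β) (z := 2 * √(α * β * x)) (by positivity) hx1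
  rw [mul_sqrt_rpow zero_le_two (by positivity) hx.le] at hb
  have he : x ^ (min α β - 1) = x ^ ((α + β) / 2 - 1) * x ^ (-|α - β| / 2) := by
    rw [← Real.rpow_add hx, min_eq_half_sub_abs]; congr 1; ring
  rw [gammaGammaPDFReal, if_pos hx, he]
  calc _ = 2 * (α * β) ^ ((α + β) / 2) / (Real.Gamma α * Real.Gamma β) * x ^ ((α + β) / 2 - 1) *
        (Real.exp (-Real.exp 1) / 2 *
          (2 ^ (-|α - β|) * (α * β) ^ (-|α - β| / 2) * x ^ (-|α - β| / 2))) := by ring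
    _ ≤ _ := mul_le_mul_of_nonneg_left hb (by positivity)

theorem gammaGammaMeasure_Iic_zero (α β : ℝ) : gammaGammaMeasure α β (Set.Iic 0) = 0 := by
  rw [gammaGammaMeasure, withDensity_apply _ measurableSet_Iic,
    setLIntegral_congr_fun (g := fun _ => 0) measurableSet_Iic]
  · simp
  · intro x hx
    simp [gammaGammaPDFReal, not_lt.2 (Set.mem_Iic.1 hx)]

theorem exists_gammaGammaMeasure_Iic_le {α β ε : ℝ} (hα : 0 < α) (hβ : 0 < β) (hε : 0 < ε)
    (hεq : ε < min α β) :
    ∃ C > 0, ∀ x > 0, (gammaGammaMeasure α β).real (Set.Iic x) ≤ C * x ^ (min α β - ε) := by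
  obtain ⟨C, hC, hle⟩ := exists_gammaGammaPDFReal_le hα hβ hε
  have hq : 0 < min α β - ε := sub_pos.2 hεq
  refine ⟨C / (min α β - ε), by positivity, fun x hx => ?_⟩
  have hint : IntegrableOn (fun t : ℝ => C * t ^ (min α β - ε - 1)) (Set.Ioc 0 x) :=
    ((intervalIntegrable_iff_integrableOn_Ioc_of_le hx.le).1
      (intervalIntegral.intervalIntegrable_rpow' (by linarith))).const_mul _
  have hval : ∫ t in Set.Ioc 0 x, C * t ^ (min α β - ε - 1) =
      C / (min α β - ε) * x ^ (min α β - ε) := by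
    rw [integral_const_mul, ← intervalIntegral.integral_of_le hx.le,
      integral_rpow (Or.inl (by linarith)), sub_add_cancel, Real.zero_rpow hq.ne']
    ring
  refine ENNReal.toReal_le_of_le_ofReal (by positivity) ?_
  calc gammaGammaMeasure α β (Set.Iic x)
      = gammaGammaMeasure α β (Set.Iic 0 ∪ Set.Ioc 0 x) := by rw [Set.Iic_union_Ioc_eq_Iic hx.le]
    _ ≤ gammaGammaMeasure α β (Set.Iic 0) + gammaGammaMeasure α β (Set.Ioc 0 x) :=
        measure_union_le _ _
    _ = ∫⁻ t in Set.Ioc 0 x, ENNReal.ofReal (gammaGammaPDFReal α β t) := by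
        rw [gammaGammaMeasure_Iic_zero, zero_add, gammaGammaMeasure,
          withDensity_apply _ measurableSet_Ioc]
    _ ≤ ∫⁻ t in Set.Ioc 0 x, ENNReal.ofReal (C * t ^ (min α β - ε - 1)) :=
        setLIntegral_mono' measurableSet_Ioc fun t ht => ENNReal.ofReal_le_ofReal (hle t ht.1)
    _ = _ := by
        rw [← hval, ofReal_integral_eq_lintegral_ofReal hint]
        filter_upwards [ae_restrict_mem measurableSet_Ioc] with t ht
        exact mul_nonneg hC.le (Real.rpow_nonneg ht.1.le _)

theorem exists_le_gammaGammaMeasure_Iio {α β : ℝ} (hα : 0 < α) (hβ : 0 < β)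
    [IsFiniteMeasure (gammaGammaMeasure α β)] :
    ∃ c > 0, ∀ᶠ x in 𝓝[>] (0 : ℝ),
      c * x ^ (min α β) ≤ (gammaGammaMeasure α β).real (Set.Iio x) := by
  obtain ⟨c, hc, hle⟩ := exists_le_gammaGammaPDFReal hα hβ
  have hq : 0 < min α β := lt_min hα hβ
  obtain ⟨δ, hδ, hδle⟩ := mem_nhdsGT_iff_exists_Ioo_subset.1 hle
  refine ⟨c * (1 / 2) ^ min α β / 2, by positivity, ?_⟩
  filter_upwards [Ioo_mem_nhdsGT hδ] with x hx
  have hx0 : 0 < x := hx.1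
  have hden : ∀ t ∈ Set.Ioo (x / 2) x,
      c * (1 / 2) ^ min α β * (x ^ min α β / x) ≤ gammaGammaPDFReal α β t := by
    intro t ht
    have ht0 : 0 < t := by linarith [ht.1]
    refine le_trans ?_ (hδle ⟨ht0, ht.2.trans hx.2⟩)
    -- The exponent `min α β - 1` may have either sign, so `t ^ min α β` and `1 / t` are bounded
    -- below separately.
    rw [Real.rpow_sub_one ht0.ne', mul_assoc]
    refine mul_le_mul_of_nonneg_left ?_ hc.le
    calc _ = (1 / 2 * x) ^ min α β / x := by
          rw [Real.mul_rpow (by norm_num) hx0.le]; ring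
      _ ≤ _ := by
          have h1 : (1 / 2 * x) ^ min α β ≤ t ^ min α β :=
            Real.rpow_le_rpow (by positivity) (by linarith [ht.1]) hq.le
          exact div_le_div₀ (by positivity) h1 ht0 ht.2.le
  rw [measureReal_def, ← ENNReal.ofReal_le_iff_le_toReal (measure_ne_top _ _)]
  calc _ = ENNReal.ofReal (c * (1 / 2) ^ min α β * (x ^ min α β / x)) * volume (Set.Ioo (x / 2) x) := by
        rw [Real.volume_Ioo, ← ENNReal.ofReal_mul (by positivity)]
        congr 1
        field_simp
        ring
    _ = ∫⁻ t in Set.Ioo (x / 2) x, ENNReal.ofReal (c * (1 / 2) ^ min α β * (x ^ min α β / x)) := by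
        rw [setLIntegral_const]
    _ ≤ ∫⁻ t in Set.Ioo (x / 2) x, ENNReal.ofReal (gammaGammaPDFReal α β t) :=
        setLIntegral_mono' measurableSet_Ioo fun t ht => ENNReal.ofReal_le_ofReal (hden t ht)
    _ = gammaGammaMeasure α β (Set.Ioo (x / 2) x) := by
        rw [gammaGammaMeasure, withDensity_apply _ measurableSet_Ioo]
    _ ≤ _ := measure_mono Set.Ioo_subset_Iio_self

/-! ### Absorbing constants into powers, and passing to logarithms. -/

theorem eventually_const_mul_rpow_le (C : ℝ) {r s : ℝ} (h : r < s) :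
    ∀ᶠ P : ℝ in atTop, C * P ^ r ≤ P ^ s := by
  filter_upwards [(tendsto_rpow_atTop (sub_pos.2 h)).eventually_ge_atTop C,
    eventually_gt_atTop 0] with P hP hP0
  calc _ ≤ P ^ (s - r) * P ^ r := mul_le_mul_of_nonneg_right hP (by positivity)
    _ = _ := by rw [← Real.rpow_add hP0, sub_add_cancel]

theorem eventually_rpow_le_const_mul {c : ℝ} (hc : 0 < c) {r s : ℝ} (h : r < s) :
    ∀ᶠ P : ℝ in atTop, P ^ r ≤ c * P ^ s := by
  filter_upwards [eventually_const_mul_rpow_le c⁻¹ h] with P hP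
  rwa [inv_mul_le_iff₀ hc] at hP

theorem eventually_gammaGammaMeasure_Iic_le {α β a ε : ℝ} (hα : 0 < α) (hβ : 0 < β) (ha : 0 < a)
    (hε : 0 < ε) :
    ∀ᶠ P : ℝ in atTop,
      (gammaGammaMeasure α β).real (Set.Iic (a / P)) ≤ P ^ (-(min α β - ε)) := by
  have hq : 0 < min α β := lt_min hα hβ
  -- `δ < min α β` keeps the density bound integrable at `0`; `δ < ε` leaves room to absorb the
  -- constant.
  set δ := min (ε / 2) (min α β / 2) with hδ
  have hδ0 : 0 < δ := by positivity
  have hδq : δ < min α β := (min_le_right _ _).trans_lt (by linarith)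
  have hδε : δ < ε := (min_le_left _ _).trans_lt (by linarith)
  obtain ⟨C, hC, hle⟩ := exists_gammaGammaMeasure_Iic_le hα hβ hδ0 hδq
  filter_upwards [eventually_gt_atTop 0, eventually_const_mul_rpow_le (C * a ^ (min α β - δ))
    (show -(min α β - δ) < -(min α β - ε) by linarith)] with P hP0 hP
  refine (hle _ (by positivity)).trans (le_trans (le_of_eq ?_) hP)
  rw [Real.div_rpow ha.le hP0.le, Real.rpow_neg hP0.le]
  ring

theorem eventually_le_gammaGammaMeasure_Iio {α β a ε : ℝ} (hα : 0 < α) (hβ : 0 < β) (ha : 0 < a)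
    (hε : 0 < ε) [IsFiniteMeasure (gammaGammaMeasure α β)] :
    ∀ᶠ P : ℝ in atTop,
      P ^ (-(min α β + ε)) ≤ (gammaGammaMeasure α β).real (Set.Iio (a / P)) := by
  obtain ⟨c, hc, hle⟩ := exists_le_gammaGammaMeasure_Iio hα hβ
  have hlim : Tendsto (fun P : ℝ => a / P) atTop (𝓝[>] 0) :=
    tendsto_nhdsWithin_iff.2 ⟨tendsto_const_nhds.div_atTop tendsto_id,
      (eventually_gt_atTop 0).mono fun P hP => div_pos ha hP⟩
  filter_upwards [eventually_gt_atTop 0, hlim.eventually hle,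
    eventually_rpow_le_const_mul (c := c * a ^ min α β) (by positivity)
    (show -(min α β + ε) < -min α β by linarith)] with P hP0 hP1 hP2
  refine hP2.trans (le_trans (le_of_eq ?_) hP1)
  rw [Real.div_rpow ha.le hP0.le, Real.rpow_neg hP0.le]
  ring

theorem tendsto_neg_log_div_log {ι : Type*} {l : Filter ι} {P f : ι → ℝ} {G : ℝ}
    (hP : Tendsto P l atTop)
    (hf : ∀ ε > 0, ∀ᶠ i in l, P i ^ (-(G + ε)) ≤ f i ∧ f i ≤ P i ^ (-(G - ε))) :
    Tendsto (fun i => -(Real.log (f i) / Real.log (P i))) l (𝓝 G) := by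
  rw [Metric.tendsto_nhds]
  intro ε hε
  filter_upwards [hf (ε / 2) (by positivity), hP.eventually_gt_atTop 1] with i ⟨h1, h2⟩ hPi
  have hP0 : 0 < P i := by linarith
  have hlog : 0 < Real.log (P i) := Real.log_pos hPi
  -- The lower bound also excludes `f i = 0`, where `Real.log` takes a default value.
  have hf0 : 0 < f i := (Real.rpow_pos_of_pos hP0 _).trans_le h1
  have h1' := Real.log_le_log (Real.rpow_pos_of_pos hP0 _) h1
  have h2' := Real.log_le_log hf0 h2
  rw [Real.log_rpow hP0] at h1' h2'
  have h3 := (le_div_iff₀ hlog).2 h1'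
  have h4 := (div_le_iff₀ hlog).2 h2'
  rw [Real.dist_eq, abs_lt]
  constructor <;> linarith

/-! ### The SNR in terms of the power margin. -/

namespace OpticalParams

variable (s : OpticalParams)

theorem powerMargin_pos : 0 < s.powerMargin := by
  have := s.eta_pos
  have := s.Tb_pos
  have := s.Pt_pos
  have := s.N0_pos
  have := s.gammaTh_pos
  unfold powerMargin
  positivity

/-- Hence all threshold comparisons depend on the parameters through `powerMargin` alone. -/
theorem snr_eq (g : ℝ) : s.snr g = s.gammaTh * (s.powerMargin * g) ^ 2 := by
  have := s.N0_pos
  have := s.gammaTh_pos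
  rw [snr, powerMargin, mul_pow, div_pow, Real.sq_sqrt (by positivity)]
  field_simp

theorem snr_lt_gammaTh_iff {g : ℝ} (hg : 0 ≤ g) : s.snr g < s.gammaTh ↔ s.powerMargin * g < 1 := by
  rw [snr_eq, mul_lt_iff_lt_one_right s.gammaTh_pos,
    sq_lt_one_iff₀ (mul_nonneg s.powerMargin_pos.le hg)]

theorem snr_le_gammaTh_iff {g : ℝ} (hg : 0 ≤ g) : s.snr g ≤ s.gammaTh ↔ s.powerMargin * g ≤ 1 := by
  rw [snr_eq, mul_le_iff_le_one_right s.gammaTh_pos,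
    sq_le_one_iff₀ (mul_nonneg s.powerMargin_pos.le hg)]

end OpticalParams

/-! ### Outage as simultaneous fading of critical links. -/

variable {N : ℕ} {Ω : Type*}

open Classical in
/-- The link through relay `m` that must be in a deep fade for an outage in which the relays of
`S` decode: the relay-destination link if `m ∈ S`, the source-relay link otherwise. -/
def criticalLink (S : Finset (Fin N)) (m : Fin N) : Link N :=
  if m ∈ S then Link.RD m else Link.SR m

theorem criticalLink_injective (S : Finset (Fin N)) : Function.Injective (criticalLink S) := by
  intro m m' h
  unfold criticalLink at h
  split_ifs at h <;> simpa using h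

theorem sum_criticalLink (S : Finset (Fin N)) (q : Link N → ℝ) :
    ∑ m, q (criticalLink S m) = ∑ m ∈ Sᶜ, q (Link.SR m) + ∑ m ∈ S, q (Link.RD m) := by
  rw [← Finset.sum_compl_add_sum S]
  congr 1
  · exact Finset.sum_congr rfl fun m hm => by
      rw [criticalLink, if_neg (Finset.mem_compl.1 hm)]
  · exact Finset.sum_congr rfl fun m hm => by rw [criticalLink, if_pos hm]

theorem mem_decodingSet {s : OpticalParams} {ρ hbar : Link N → ℝ} {htilde : Link N → Ω → ℝ} {ω : Ω}
    {m : Fin N} : m ∈ decodingSet s ρ hbar htilde ω ↔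
      s.gammaTh < s.snr (ρ (Link.SR m) * channelGain hbar htilde (Link.SR m) ω) := by
  simp [decodingSet]

section Events

variable (s : OpticalParams) {ρ hbar : Link N → ℝ} {htilde : Link N → Ω → ℝ} {ω : Ω}

/-- The witness is the decoding set itself: a sum of nonnegative terms below the threshold has every
term below it. -/
theorem exists_fade_of_outage (hω : ∀ l, 0 ≤ htilde l ω) (hρ : ∀ l, 0 < ρ l)
    (hhbar : ∀ l, 0 < hbar l)
    (h : decodingSet s ρ hbar htilde ω = ∅ ∨ destinationSNR s ρ hbar htilde ω < s.gammaTh) :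
    ∃ S : Finset (Fin N), ∀ m,
      htilde (criticalLink S m) ω ≤
        1 / (ρ (criticalLink S m) * hbar (criticalLink S m)) / s.powerMargin := by
  have hP := s.powerMargin_pos
  have hg : ∀ l, 0 ≤ ρ l * channelGain hbar htilde l ω := fun l =>
    mul_nonneg (hρ l).le (mul_nonneg (hhbar l).le (hω l))
  have key : ∀ l, s.powerMargin * (ρ l * channelGain hbar htilde l ω) ≤ 1 →
      htilde l ω ≤ 1 / (ρ l * hbar l) / s.powerMargin := fun l hl => by
    have := hρ l
    have := hhbar l
    rw [div_div, le_div_iff₀ (by positivity)]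
    rw [channelGain] at hl
    linarith
  refine ⟨decodingSet s ρ hbar htilde ω, fun m => key _ ?_⟩
  by_cases hm : m ∈ decodingSet s ρ hbar htilde ω
  · rw [criticalLink, if_pos hm]
    have hd := h.resolve_left (Finset.ne_empty_of_mem hm)
    rw [destinationSNR, s.snr_lt_gammaTh_iff (Finset.sum_nonneg fun m _ => hg _)] at hd
    exact (mul_le_mul_of_nonneg_left
      (Finset.single_le_sum (f := fun m => ρ (Link.RD m) * channelGain hbar htilde (Link.RD m) ω)
        (fun m _ => hg _) hm) hP.le).trans hd.le
  · rw [criticalLink, if_neg hm, ← s.snr_le_gammaTh_iff (hg _)]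
    exact not_lt.1 fun h' => hm (mem_decodingSet.2 h')

/-- The factor `1 / N` keeps a sum of at most `N` second-hop terms below the threshold. Only
`decodingSet ⊆ S` is needed: relays of `S` that fail to decode merely drop out of the sum. -/
theorem outage_of_fade (hω : ∀ l, 0 ≤ htilde l ω) (hρ : ∀ l, 0 < ρ l)
    (hhbar : ∀ l, 0 < hbar l) (S : Finset (Fin N))
    (h : ∀ m, htilde (criticalLink S m) ω <
      1 / (N * (ρ (criticalLink S m) * hbar (criticalLink S m))) / s.powerMargin) :
    decodingSet s ρ hbar htilde ω = ∅ ∨ destinationSNR s ρ hbar htilde ω < s.gammaTh := by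
  have hP := s.powerMargin_pos
  have hg : ∀ l, 0 ≤ ρ l * channelGain hbar htilde l ω := fun l =>
    mul_nonneg (hρ l).le (mul_nonneg (hhbar l).le (hω l))
  have key : ∀ m, s.powerMargin * (ρ (criticalLink S m) *
      channelGain hbar htilde (criticalLink S m) ω) < 1 / N := fun m => by
    have := hρ (criticalLink S m)
    have := hhbar (criticalLink S m)
    have hN : (0 : ℝ) < N := by exact_mod_cast m.pos
    have hm := h m
    rw [div_div, lt_div_iff₀ (by positivity)] at hm
    rw [lt_div_iff₀ hN, channelGain]
    linarith
  have hsub : decodingSet s ρ hbar htilde ω ⊆ S := fun m hm => by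
    by_contra hmS
    have hN : (1 : ℝ) ≤ N := by exact_mod_cast m.pos
    have hk := key m
    rw [criticalLink, if_neg hmS] at hk
    refine absurd (mem_decodingSet.1 hm) (not_lt.2 ((s.snr_le_gammaTh_iff (hg _)).2 ?_))
    exact hk.le.trans ((div_le_one (by linarith)).2 hN)
  refine (decodingSet s ρ hbar htilde ω).eq_empty_or_nonempty.imp_right fun hne => ?_
  rw [destinationSNR, s.snr_lt_gammaTh_iff (Finset.sum_nonneg fun m _ => hg _), Finset.mul_sum]
  have hN : (0 : ℝ) < N := by exact_mod_cast hne.choose.pos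
  calc _ < ∑ m ∈ decodingSet s ρ hbar htilde ω, 1 / (N : ℝ) :=
        Finset.sum_lt_sum_of_nonempty hne fun m hm => by
          simpa only [criticalLink, if_pos (hsub hm)] using key m
    _ ≤ ∑ m : Fin N, 1 / (N : ℝ) :=
        Finset.sum_le_sum_of_subset_of_nonneg (Finset.subset_univ _) fun _ _ _ => by positivity
    _ = 1 := by
        simp [hN.ne']

end Events

/-! ### Probabilities of the fading events. -/

section Probability

variable [MeasurableSpace Ω] {μ : Measure Ω} {α β : Link N → ℝ}
  {htilde : Link N → Ω → ℝ}

theorem ae_htilde_nonneg (hlaw : ∀ l, HasLaw (htilde l) (gammaGammaMeasure (α l) (β l)) μ) :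
    ∀ᵐ ω ∂μ, ∀ l, 0 ≤ htilde l ω := by
  have : Countable (Link N) := by
    refine Function.Injective.countable (β := Fin N ⊕ Fin N)
      (f := fun l => match l with | .SR m => .inl m | .RD m => .inr m) ?_
    rintro (m | m) (m' | m') h <;> simp_all
  refine ae_all_iff.2 fun l => ?_
  have h0 : μ {ω | htilde l ω ∈ Set.Iic 0} = 0 := by
    rw [(hlaw l).measure_eq (p := fun x => x ∈ Set.Iic 0) measurableSet_Iic]
    exact gammaGammaMeasure_Iic_zero _ _
  filter_upwards [measure_eq_zero_iff_ae_notMem.1 h0] with ω hω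
  exact (not_le.1 hω).le

theorem measureReal_iInter_preimage_eq_prod (hindep : iIndepFun htilde μ)
    (hlaw : ∀ l, HasLaw (htilde l) (gammaGammaMeasure (α l) (β l)) μ)
    {j : Fin N → Link N} (hj : Function.Injective j) {A : Fin N → Set ℝ}
    (hA : ∀ m, MeasurableSet (A m)) :
    μ.real {ω | ∀ m, htilde (j m) ω ∈ A m} =
      ∏ m, (gammaGammaMeasure (α (j m)) (β (j m))).real (A m) := by
  have h := (hindep.precomp hj).measure_inter_preimage_eq_mul Finset.univ (fun m _ => hA m)
  have hset : {ω | ∀ m, htilde (j m) ω ∈ A m} = ⋂ m ∈ Finset.univ, htilde (j m) ⁻¹' A m := by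
    ext; simp
  rw [measureReal_def, hset]
  refine (congrArg ENNReal.toReal h).trans ?_
  rw [ENNReal.toReal_prod]
  refine Finset.prod_congr rfl fun m _ => ?_
  exact (hlaw (j m)).measureReal_eq (p := fun x => x ∈ A m) (hA m)

theorem eventually_measureReal_fade_le (hindep : iIndepFun htilde μ)
    (hlaw : ∀ l, HasLaw (htilde l) (gammaGammaMeasure (α l) (β l)) μ)
    (hα : ∀ l, 0 < α l) (hβ : ∀ l, 0 < β l) {a : Link N → ℝ} (ha : ∀ l, 0 < a l)
    {j : Fin N → Link N} (hj : Function.Injective j) {ε : ℝ} (hε : 0 < ε) :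
    ∀ᶠ P : ℝ in atTop, μ.real {ω | ∀ m, htilde (j m) ω ≤ a (j m) / P} ≤
      P ^ (-(∑ m, min (α (j m)) (β (j m)) - N * ε)) := by
  filter_upwards [eventually_gt_atTop 0, eventually_all.2 fun m =>
    eventually_gammaGammaMeasure_Iic_le (hα (j m)) (hβ (j m)) (ha (j m)) hε] with P hP0 hP
  refine (measureReal_iInter_preimage_eq_prod (A := fun m => Set.Iic (a (j m) / P)) hindep hlaw hj
    fun m => measurableSet_Iic).trans_le ?_
  refine (Finset.prod_le_prod (fun _ _ => measureReal_nonneg) fun m _ => hP m).trans_eq ?_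
  rw [← Real.rpow_sum_of_pos hP0]
  simp

variable [IsProbabilityMeasure μ]

theorem eventually_le_measureReal_fade (hindep : iIndepFun htilde μ)
    (hlaw : ∀ l, HasLaw (htilde l) (gammaGammaMeasure (α l) (β l)) μ)
    (hα : ∀ l, 0 < α l) (hβ : ∀ l, 0 < β l) {a : Link N → ℝ} (ha : ∀ l, 0 < a l)
    {j : Fin N → Link N} (hj : Function.Injective j) {ε : ℝ} (hε : 0 < ε) :
    ∀ᶠ P : ℝ in atTop, P ^ (-(∑ m, min (α (j m)) (β (j m)) + N * ε)) ≤
      μ.real {ω | ∀ m, htilde (j m) ω < a (j m) / P} := by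
  -- Finiteness comes from being the law of a random variable, so the density need not be
  -- integrated.
  have hfin : ∀ l, IsFiniteMeasure (gammaGammaMeasure (α l) (β l)) := fun l => by
    rw [← (hlaw l).map_eq]; infer_instance
  filter_upwards [eventually_gt_atTop 0, eventually_all.2 fun m =>
    eventually_le_gammaGammaMeasure_Iio (hα (j m)) (hβ (j m)) (ha (j m)) hε] with P hP0 hP
  refine le_trans ?_ (measureReal_iInter_preimage_eq_prod (A := fun m => Set.Iio (a (j m) / P))
    hindep hlaw hj fun m => measurableSet_Iio).ge
  refine le_trans (le_of_eq ?_)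
    (Finset.prod_le_prod (fun _ _ => Real.rpow_nonneg hP0.le _) fun m _ => hP m)
  rw [← Real.rpow_sum_of_pos hP0]
  simp [Finset.sum_add_distrib, add_comm]

theorem allActiveOutage_le (s : OpticalParams) {ρ hbar : Link N → ℝ} (hρ : ∀ l, 0 < ρ l)
    (hhbar : ∀ l, 0 < hbar l)
    (hlaw : ∀ l, HasLaw (htilde l) (gammaGammaMeasure (α l) (β l)) μ) :
    allActiveOutage μ ρ hbar htilde s ≤
      ∑ S : Finset (Fin N), μ.real {ω | ∀ m, htilde (criticalLink S m) ω ≤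
        1 / (ρ (criticalLink S m) * hbar (criticalLink S m)) / s.powerMargin} := by
  refine le_trans ?_ (measureReal_iUnion_fintype_le _)
  refine ENNReal.toReal_mono (measure_ne_top _ _) (measure_mono_ae ?_)
  filter_upwards [ae_htilde_nonneg hlaw] with ω hω h
  exact Set.mem_iUnion.2 (exists_fade_of_outage s hω hρ hhbar h)

theorem le_allActiveOutage (s : OpticalParams) {ρ hbar : Link N → ℝ} (hρ : ∀ l, 0 < ρ l)
    (hhbar : ∀ l, 0 < hbar l)
    (hlaw : ∀ l, HasLaw (htilde l) (gammaGammaMeasure (α l) (β l)) μ) (S : Finset (Fin N)) :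
    μ.real {ω | ∀ m, htilde (criticalLink S m) ω <
        1 / (N * (ρ (criticalLink S m) * hbar (criticalLink S m))) / s.powerMargin} ≤
      allActiveOutage μ ρ hbar htilde s := by
  refine ENNReal.toReal_mono (measure_ne_top _ _) (measure_mono_ae ?_)
  filter_upwards [ae_htilde_nonneg hlaw] with ω hω h
  exact outage_of_fade s hω hρ hhbar S h

end Probability

end FSO

end

/-! ### The diversity gain. -/

theorem corollary1 {N : ℕ} {Ω : Type*} [MeasurableSpace Ω] (μ : Measure Ω) [IsProbabilityMeasure μ]
    (α β hbar ρ : FSO.Link N → ℝ)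
    (hα : ∀ l, 0 < α l) (hβ : ∀ l, 0 < β l)
    (hαβ : ∀ l, ∀ k : ℤ, α l - β l ≠ (k : ℝ))
    (hhbar : ∀ l, 0 < hbar l)
    (hρ : ∀ l, 0 < ρ l)
    (hρ_sum : ∑ m : Fin N, (ρ (FSO.Link.SR m) + ρ (FSO.Link.RD m)) = 1)
    (htilde : FSO.Link N → Ω → ℝ)
    (hlaw : ∀ l, HasLaw (htilde l) (FSO.gammaGammaMeasure (α l) (β l)) μ)
    (hindep : iIndepFun htilde μ) :
    FSO.HasDiversityGain (FSO.allActiveOutage μ ρ hbar htilde)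
      ((Finset.univ : Finset (Finset (Fin N))).inf' Finset.univ_nonempty fun S =>
        ∑ m ∈ Sᶜ, min (α (FSO.Link.SR m)) (β (FSO.Link.SR m))
          + ∑ m ∈ S, min (α (FSO.Link.RD m)) (β (FSO.Link.RD m))) := by
  -- With no relays the power fractions would sum to `0`, not `1`.
  have hN : (0 : ℝ) < N := by
    rcases N.eq_zero_or_pos with rfl | h
    · simp at hρ_sum
    · exact_mod_cast h
  simp only [← FSO.sum_criticalLink _ fun l => min (α l) (β l)]
  set G := (Finset.univ : Finset (Finset (Fin N))).inf' Finset.univ_nonempty fun S =>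
    ∑ m, min (α (FSO.criticalLink S m)) (β (FSO.criticalLink S m)) with hG
  refine FSO.tendsto_neg_log_div_log tendsto_comap fun ε hε => ?_
  -- The `N` links together lose `ε / 2` in the exponent; in the upper bound the other half absorbs
  -- the number of sets `S`.
  have hδ : 0 < ε / (2 * N) := by positivity
  have hNδ : N * (ε / (2 * N)) = ε / 2 := by field_simp
  have hρh : ∀ l, 0 < ρ l * hbar l := fun l => mul_pos (hρ l) (hhbar l)
  refine Eventually.and ?_ ?_
  -- For the lower bound, one minimizing `S` is enough.
  · obtain ⟨S, -, hS⟩ := Finset.exists_mem_eq_inf' Finset.univ_nonempty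
      fun S : Finset (Fin N) => ∑ m, min (α (FSO.criticalLink S m)) (β (FSO.criticalLink S m))
    have h := FSO.eventually_le_measureReal_fade hindep hlaw hα hβ
      (a := fun l => 1 / (N * (ρ l * hbar l)))
      (fun l => one_div_pos.2 (mul_pos hN (hρh l))) (FSO.criticalLink_injective S) hδ
    filter_upwards [tendsto_comap.eventually h, tendsto_comap.eventually (eventually_ge_atTop 1)]
      with s hs hs1
    refine le_trans ?_ (hs.trans (FSO.le_allActiveOutage s hρ hhbar hlaw S))
    exact Real.rpow_le_rpow_of_exponent_le hs1 (by rw [hNδ, ← hS]; linarith)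
  · have h := eventually_all.2 fun S : Finset (Fin N) =>
      FSO.eventually_measureReal_fade_le hindep hlaw hα hβ (a := fun l => 1 / (ρ l * hbar l))
        (fun l => one_div_pos.2 (hρh l)) (FSO.criticalLink_injective S) hδ
    filter_upwards [tendsto_comap.eventually h, tendsto_comap.eventually (eventually_ge_atTop 1),
      tendsto_comap.eventually (FSO.eventually_const_mul_rpow_le
        (Fintype.card (Finset (Fin N))) (show -(G - ε / 2) < -(G - ε) by linarith))]
      with s hs hs1 hs2
    refine (FSO.allActiveOutage_le s hρ hhbar hlaw).trans (le_trans ?_ hs2)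
    rw [← nsmul_eq_mul, ← Finset.card_univ, ← Finset.sum_const]
    refine Finset.sum_le_sum fun S _ => (hs S).trans ?_
    refine Real.rpow_le_rpow_of_exponent_le hs1 ?_
    have := Finset.inf'_le (fun S : Finset (Fin N) =>
      ∑ m, min (α (FSO.criticalLink S m)) (β (FSO.criticalLink S m))) (Finset.mem_univ S)
    rw [hNδ]
    linarith
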